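/- Let $X$ be a measurable space and let $\mathcal H$ be a separable complex Hilbert space, with algebra of bounded operators $\mathcal B(\mathcal H)$. A \emph{POVM} on $X$ with values in $\mathcal B(\mathcal H)$ assigns to each measurable set $A$ a positive operator $\mu(A)\in\mathcal B(\mathcal H)$ such that $A\mapsto\langle h,\mu(A)k\rangle$ is a complex measure for all $h,k\in\mathcal H$. It is \emph{normalized} if $\mu(X)=I_{\mathcal H}$, and \emph{spectral} if it is normalized and every $\mu(A)$ is an orthogonal projection. A measurable set $A$ is an \emph{atom} for $\mu$ if $\mu(A)\neq 0$ and every measurable $B\subseteq A$ satisfies $\mu(B)=0$ or $\mu(B)=\mu(A)$; $\mu$ is \emph{atomic} if every measurable $A$ with $\mu(A)\ne 0$ contains an atom, and \emph{non-atomic} if it has no atom. Two POVMs $\mu_1,\mu_2$ on $X$ (possibly acting on different spaces) are \emph{mutually singular} if there are disjoint measurable sets $X_1,X_2$ with $\mu_i(A)=\mu_i(A\cap X_i)$ for all measurable $A$ and $i=1,2$. A normalized POVM $\mu$ is \emph{$C^*$-extreme} if, whenever $\mu(\cdot)=\sum_{i=1}^n T_i^*\nu_i(\cdot)T_i$ with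 normalized POVMs $\nu_i$ with values in $\mathcal B(\mathcal H)$ and invertible $T_i\in\mathcal B(\mathcal H)$ such that $\sum_{i=1}^n T_i^*T_i=I_{\mathcal H}$, there are unitaries $U_i\in\mathcal B(\mathcal H)$ with $\nu_i(\cdot)=U_i^*\mu(\cdot)U_i$ for $1\le i\le n$. \textbf{Theorem.} Let $\mu$ be a $C^*$-extreme normalized POVM on $X$ with values in $\mathcal B(\mathcal H)$. Then there are an orthogonal decomposition $\mathcal H=\mathcal K_1\oplus\mathcal K_2$ into closed subspaces (either of which may be $\{0\}$) and normalized POVMs $\mu_i$ on $X$ with values in $\mathcal B(\mathcal K_i)$, $i=1,2$, such that $\mu=\mu_1\oplus\mu_2$, that is, $\mu(A)(x+y)=\mu_1(A)x+\mu_2(A)y$ for all measurable $A$, $x\in\mathcal K_1$, $y\in\mathcal K_2$, and such that $\mu_1$ is atomic, $\mu_2$ is non-atomic, and $\mu_1,\mu_2$ are mutually singular. Such a decomposition is unique: the subspaces $\mathcal K_1,\mathcal K_2$ and the POVMs $\mu_1,\mu_2$ are determined by $\mu$. Moreover, $\mu_1$ and $\mu_2$ are $C^*$-extreme among the normalized POVMs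 on $X$ with values in $\mathcal B(\mathcal K_1)$ and $\mathcal B(\mathcal K_2)$ respectively, and $\mu_1$ is spectral. -/

import Mathlib

/-- A positive operator valued measure on the measurable space `X` with values in the bounded
operators on the complex inner product space `H`. As for Mathlib's vector measures, the value on
non-measurable sets is fixed to be `0`, so that two such measures are equal exactly when they agree
on all measurable sets. -/
@[ext]
structure POVM (X : Type*) [MeasurableSpace X] (H : Type*) [NormedAddCommGroup H]
    [InnerProductSpace ℂ H] where
  toFun : Set X → (H →L[ℂ] H)
  isPositive' : ∀ A, MeasurableSet A → (toFun A).IsPositive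
  isComplexMeasure' : ∀ h k : H, ∃ m : MeasureTheory.ComplexMeasure X,
    ∀ A, MeasurableSet A → m A = inner ℂ h (toFun A k)
  not_measurable' : ∀ A, ¬ MeasurableSet A → toFun A = 0

namespace POVM

section Basic

variable {X : Type*} [MeasurableSpace X]
variable {H : Type*} [NormedAddCommGroup H] [InnerProductSpace ℂ H]

instance : CoeFun (POVM X H) (fun _ => Set X → (H →L[ℂ] H)) := ⟨POVM.toFun⟩

/-- `μ(X)` is the identity operator. -/
def IsNormalized (μ : POVM X H) : Prop := μ Set.univ = 1

/-- `A` is an atom for `μ`. -/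
def IsAtom (μ : POVM X H) (A : Set X) : Prop :=
  MeasurableSet A ∧ μ A ≠ 0 ∧ ∀ B, MeasurableSet B → B ⊆ A → μ B = 0 ∨ μ B = μ A

/-- Every measurable set of non-zero measure contains an atom. -/
def IsAtomic (μ : POVM X H) : Prop :=
  ∀ A, MeasurableSet A → μ A ≠ 0 → ∃ B, B ⊆ A ∧ μ.IsAtom B

/-- There are no atoms. -/
def IsNonAtomic (μ : POVM X H) : Prop := ∀ A, ¬ μ.IsAtom A

/-- Mutual singularity of two POVMs, possibly acting on different spaces: they are concentrated on
disjoint measurable sets. -/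
def MutuallySingular {H₁ H₂ : Type*} [NormedAddCommGroup H₁] [InnerProductSpace ℂ H₁]
    [NormedAddCommGroup H₂] [InnerProductSpace ℂ H₂] (μ₁ : POVM X H₁) (μ₂ : POVM X H₂) : Prop :=
  ∃ X₁ X₂ : Set X, MeasurableSet X₁ ∧ MeasurableSet X₂ ∧ Disjoint X₁ X₂ ∧
    (∀ A, MeasurableSet A → μ₁ A = μ₁ (A ∩ X₁)) ∧
    (∀ A, MeasurableSet A → μ₂ A = μ₂ (A ∩ X₂))

end Basic

section Hilbert

variable {X : Type*} [MeasurableSpace X]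
variable {H : Type*} [NormedAddCommGroup H] [InnerProductSpace ℂ H] [CompleteSpace H]

/-- A spectral measure: normalized, and all its values are (orthogonal) projections. -/
def IsSpectral (μ : POVM X H) : Prop :=
  μ.IsNormalized ∧ ∀ A, MeasurableSet A → IsStarProjection (μ A)

/-- `μ = ∑ Tᵢ* νᵢ(·) Tᵢ` is a proper `C*`-convex combination of the normalized POVMs `νᵢ`: the
coefficients `Tᵢ` are invertible and `∑ Tᵢ* Tᵢ` is the identity. -/
def IsProperCStarCombination (μ : POVM X H) {n : ℕ} (ν : Fin n → POVM X H)
    (T : Fin n → (H →L[ℂ] H)) : Prop :=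
  (∀ i, (ν i).IsNormalized) ∧ (∀ i, IsUnit (T i)) ∧ ∑ i, star (T i) * T i = 1 ∧
    ∀ A, MeasurableSet A → μ A = ∑ i, star (T i) * ν i A * T i

/-- `ν = U* μ(·) U` for some unitary `U`. -/
def UnitarilyEquivalent (ν μ : POVM X H) : Prop :=
  ∃ U ∈ unitary (H →L[ℂ] H), ∀ A, MeasurableSet A → ν A = star U * μ A * U

/-- `μ` is a `C*`-extreme point of the set of normalized POVMs on `X` with values in the bounded
operators on `H`. -/
def IsCStarExtreme (μ : POVM X H) : Prop :=
  μ.IsNormalized ∧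
    ∀ (n : ℕ) (ν : Fin n → POVM X H) (T : Fin n → (H →L[ℂ] H)),
      μ.IsProperCStarCombination ν T → ∀ i, (ν i).UnitarilyEquivalent μ

instance (K : ClosedSubmodule ℂ H) : CompleteSpace K.toSubmodule :=
  inferInstanceAs (CompleteSpace K)

/-- A decomposition `μ = μ₁ ⊕ μ₂` along an orthogonal decomposition `H = K₁ ⊕ K₂` into closed
subspaces (either of which may be zero). -/
structure DirectSumDecomposition (μ : POVM X H) where
  K₁ : ClosedSubmodule ℂ H
  K₂ : ClosedSubmodule ℂ H
  orthogonal_eq : K₂ = K₁ᗮ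
  μ₁ : POVM X K₁.toSubmodule
  μ₂ : POVM X K₂.toSubmodule
  eq_directSum : ∀ A, MeasurableSet A → ∀ (x : K₁.toSubmodule) (y : K₂.toSubmodule),
    μ A ((x : H) + (y : H)) = (μ₁ A x : H) + (μ₂ A y : H)

/-- The first summand is an atomic normalized POVM, the second one is a non-atomic normalized POVM,
and they are mutually singular. -/
def DirectSumDecomposition.IsAtomicNonAtomic {μ : POVM X H} (d : μ.DirectSumDecomposition) :
    Prop :=
  d.μ₁.IsNormalized ∧ d.μ₁.IsAtomic ∧ d.μ₂.IsNormalized ∧ d.μ₂.IsNonAtomic ∧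
    MutuallySingular d.μ₁ d.μ₂

end Hilbert

end POVM

/-!
An atom `A` of a `C*`-extreme `μ` can be perturbed: `μ` is the mean of the two POVMs that agree with
it off `A` and have the values `μ(A) ± D` at the atom. Extremality makes the pencil
`(μ(A) + D, 1 + D)` congruent to `(μ(A), 1)`. If `μ(A)` had a spectral value other than `0` and `1`,
suitable choices of `D` would turn every number near it into an eigenvalue of `μ(A)`, although a
self-adjoint operator on a separable space has only countably many; hence `μ(A)` is a projection.
A maximal disjoint family of atoms is therefore countable, and its union `E` carries the atomic
part: the projection `μ(E)` commutes with `μ`, and its range and kernel are the two summands.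
Uniqueness holds because another decomposition yields the same `E` up to a null set. A
`C*`-combination of one summand extends to one of `μ` by a trivial combination of the other summand;
the unitary obtained from extremality of `μ` commutes with `μ(E)`, so it is block diagonal and
restricts to each summand.
-/

section Orthogonality

variable {𝕜 E : Type*} [RCLike 𝕜] [NormedAddCommGroup E] [InnerProductSpace 𝕜 E]
  [TopologicalSpace.SeparableSpace E]

theorem countable_of_pairwise_inner_eq_zero {ι : Type*} {v : ι → E} (hv : ∀ i, v i ≠ 0)
    (h : Pairwise fun i j ↦ inner 𝕜 (v i) (v j) = 0) : Countable ι := by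
  refine Pairwise.countable_of_isOpen_disjoint (s := fun i ↦ Metric.ball (v i) (‖v i‖ / 2)) ?_
    (fun _ ↦ Metric.isOpen_ball)
    fun i ↦ ⟨v i, Metric.mem_ball_self (half_pos (norm_pos_iff.2 (hv i)))⟩
  intro i j hij
  refine Metric.ball_disjoint_ball ?_
  have hdist : ‖v i - v j‖ * ‖v i - v j‖ = ‖v i‖ * ‖v i‖ + ‖v j‖ * ‖v j‖ := by
    rw [norm_sub_mul_self (𝕜 := 𝕜), h hij, map_zero, mul_zero, sub_zero]
  rw [dist_eq_norm]
  nlinarith [norm_nonneg (v i - v j), sq_nonneg (‖v i‖ - ‖v j‖)]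

theorem countable_setOf_hasEigenvalue {T : E →ₗ[𝕜] E} (hT : T.IsSymmetric) :
    {c : 𝕜 | Module.End.HasEigenvalue T c}.Countable := by
  choose v hv using fun c : {c : 𝕜 | Module.End.HasEigenvalue T c} ↦ c.2.exists_hasEigenvector
  refine Set.countable_coe_iff.1 (countable_of_pairwise_inner_eq_zero (𝕜 := 𝕜) (v := v)
    (fun c ↦ (hv c).2) fun c d hcd ↦ ?_)
  exact hT.orthogonalFamily_eigenspaces (Subtype.coe_ne_coe.2 hcd) ⟨v c, (hv c).1⟩ ⟨v d, (hv d).1⟩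

end Orthogonality

section Calculus

theorem exists_ne_zero_cfc_mul_eq_zero {A : Type*} [CStarAlgebra A] {a : A} (ha : IsSelfAdjoint a)
    {x₀ : ℝ} (hx₀ : x₀ ∈ spectrum ℝ a) {f : ℝ → ℝ} (hf : Continuous f) (hf₀ : f =ᶠ[nhds x₀] 0) :
    ∃ b : A, b ≠ 0 ∧ cfc f a * b = 0 := by
  obtain ⟨ε, hε, hfε⟩ := Metric.eventually_nhds_iff.1 hf₀
  let bump : ℝ → ℝ := fun x ↦ max 0 (ε - |x - x₀|)
  have : Continuous bump := by fun_prop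
  refine ⟨cfc bump a, fun h ↦ ?_, ?_⟩
  · have : Nontrivial A := not_subsingleton_iff_nontrivial.1 fun _ ↦ by
      simp only [spectrum.of_subsingleton, Set.mem_empty_iff_false] at hx₀
    have hmem : bump x₀ ∈ spectrum ℝ (cfc bump a) :=
      cfc_map_spectrum bump a ▸ Set.mem_image_of_mem _ hx₀
    rw [h, spectrum.zero_eq, Set.mem_singleton_iff] at hmem
    simp only [bump, sub_self, abs_zero, sub_zero, max_eq_left_iff] at hmem
    exact hmem.not_gt hε
  · rw [← cfc_mul f bump a, ← cfc_zero (R := ℝ) (a := a)]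
    refine cfc_congr fun x _ ↦ ?_
    rcases lt_or_ge |x - x₀| ε with hx | hx
    · simp only [hfε hx, Pi.zero_apply, zero_mul]
    · simp only [bump, max_eq_left (sub_nonpos.2 hx), mul_zero, Pi.zero_apply]

theorem eventually_exists_add_eq_mul_one_add {x₀ : ℝ} (h₀ : 0 < x₀) (h₁ : x₀ ≠ 1) :
    ∀ᶠ c in nhds x₀, ∃ δ : ℝ → ℝ, Continuous δ ∧ (∀ x, 0 ≤ x → |δ x| ≤ min x 2⁻¹) ∧
      ∀ᶠ x in nhds x₀, x + δ x = c * (1 + δ x) := by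
  have hquot : ContinuousAt (fun p : ℝ × ℝ ↦ (p.1 - p.2) / (1 - p.1)) (x₀, x₀) :=
    .div (by fun_prop) (by fun_prop) (sub_ne_zero.2 h₁.symm)
  have hsmall : ∀ᶠ p : ℝ × ℝ in nhds (x₀, x₀),
      p.1 ≠ 1 ∧ |(p.1 - p.2) / (1 - p.1)| < min p.2 2⁻¹ := by
    refine (continuousAt_fst.eventually_ne h₁).and ?_
    exact hquot.abs.eventually_lt (by fun_prop) (by simpa using h₀)
  filter_upwards [hsmall.curry_nhds] with c hc
  have hc₁ : 1 - c ≠ 0 := sub_ne_zero.2 hc.self_of_nhds.1.symm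
  refine ⟨fun x ↦ max (-min x 2⁻¹) (min ((c - x) / (1 - c)) (min x 2⁻¹)), by fun_prop,
    fun x hx ↦ ?_, ?_⟩
  · have : 0 ≤ min x (2⁻¹ : ℝ) := by positivity
    exact abs_le.2 ⟨le_max_left _ _, max_le (by linarith) (min_le_right _ _)⟩
  · filter_upwards [hc] with x hx
    obtain ⟨hl, hr⟩ := abs_lt.1 hx.2
    simp only [min_eq_left hr.le, max_eq_right hl.le]
    field_simp
    ring

end Calculus

section Operators

theorem star_sqrt_smul_mul_mul {A : Type*} [Semiring A] [StarRing A] [Algebra ℝ A] [StarModule ℝ A]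
    {w : ℝ} (hw : 0 ≤ w) (a b : A) : star (√w • a) * b * (√w • a) = w • (star a * b * a) := by
  rw [star_smul, star_trivial, smul_mul_assoc, smul_mul_assoc, mul_smul_comm, smul_smul,
    Real.mul_self_sqrt hw]

variable {H : Type*} [NormedAddCommGroup H] [InnerProductSpace ℂ H] [CompleteSpace H]

theorem eventually_exists_add_apply_eq_smul {T : H →L[ℂ] H} (hT : 0 ≤ T) {x₀ : ℝ}
    (hx₀ : x₀ ∈ spectrum ℝ T) (h₀ : 0 < x₀) (h₁ : x₀ ≠ 1) :
    ∀ᶠ c : ℝ in nhds x₀, ∃ D : H →L[ℂ] H, -T ≤ D ∧ D ≤ T ∧ ‖D‖ < 1 ∧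
      ∃ v ≠ 0, (T + D) v = (c : ℂ) • (1 + D) v := by
  have hsa : IsSelfAdjoint T := .of_nonneg hT
  filter_upwards [eventually_exists_add_eq_mul_one_add h₀ h₁] with c ⟨δ, hδ, hbound, hc⟩
  have hδT : ∀ x ∈ spectrum ℝ T, |δ x| ≤ min x 2⁻¹ :=
    fun x hx ↦ hbound x (spectrum_nonneg_of_nonneg hT hx)
  refine ⟨cfc δ T, ?_, ?_, ?_, ?_⟩
  · calc -T = cfc (fun x : ℝ ↦ -x) T := (cfc_neg_id (R := ℝ) T).symm
      _ ≤ cfc δ T := cfc_mono fun x hx ↦ (abs_le.1 ((hδT x hx).trans (min_le_left _ _))).1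
  · calc cfc δ T ≤ cfc (fun x : ℝ ↦ x) T :=
          cfc_mono fun x hx ↦ (abs_le.1 ((hδT x hx).trans (min_le_left _ _))).2
      _ = T := cfc_id' ℝ T
  · refine (norm_cfc_le (c := 2⁻¹) (by norm_num) fun x hx ↦ ?_).trans_lt (by norm_num)
    exact (hδT x hx).trans (min_le_right _ _)
  · have hzero : (fun x ↦ x + δ x - c * (1 + δ x)) =ᶠ[nhds x₀] 0 :=
      hc.mono fun x hx ↦ sub_eq_zero.2 hx
    obtain ⟨b, hb, hmul⟩ := exists_ne_zero_cfc_mul_eq_zero hsa hx₀ (by fun_prop) hzero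
    have hcfc : cfc (fun x ↦ x + δ x - c * (1 + δ x)) T = T + cfc δ T - c • (1 + cfc δ T) := by
      rw [cfc_sub .., cfc_const_mul .., cfc_add .., cfc_add .., cfc_id' ℝ T, cfc_const_one ℝ T]
    obtain ⟨y, hy⟩ : ∃ y, b y ≠ 0 := by
      by_contra! h
      exact hb (ContinuousLinearMap.ext h)
    refine ⟨b y, hy, sub_eq_zero.1 ?_⟩
    simpa [hcfc] using DFunLike.congr_fun hmul y

theorem hasEigenvalue_of_star_mul_mul_apply_eq_smul {S T : H →L[ℂ] H} (hS : IsUnit S) {c : ℂ}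
    {v : H} (hv : v ≠ 0) (h : (star S * T * S) v = c • (star S * S) v) :
    Module.End.HasEigenvalue (T : H →ₗ[ℂ] H) c := by
  have hinj : ∀ {R : H →L[ℂ] H}, IsUnit R → Function.Injective R := fun hR ↦
    (ContinuousLinearMap.isUnit_iff_bijective.1 hR).injective
  have heigen : T (S v) = c • S v := hinj hS.star (h.trans (map_smul (star S) c (S v)).symm)
  exact Module.End.hasEigenvalue_of_hasEigenvector
    ⟨Module.End.mem_eigenspace_iff.2 heigen, (map_ne_zero_iff S (hinj hS)).2 hv⟩

end Operators

theorem exists_maximal_pairwiseDisjoint {α : Type*} (p : Set α → Prop) :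
    ∃ F : Set (Set α), (∀ A ∈ F, p A) ∧ F.PairwiseDisjoint id ∧
      ∀ C, p C → (∀ A ∈ F, Disjoint C A) → C ∈ F := by
  obtain ⟨F, hF⟩ := zorn_subset {F : Set (Set α) | (∀ A ∈ F, p A) ∧ F.PairwiseDisjoint id}
    fun c hc hchain ↦ ⟨⋃₀ c, ⟨fun A ⟨s, hs, hA⟩ ↦ (hc hs).1 A hA,
      (Set.pairwiseDisjoint_sUnion hchain.directedOn).2 fun s hs ↦ (hc hs).2⟩,
      fun _ ↦ Set.subset_sUnion_of_mem⟩
  refine ⟨F, hF.prop.1, hF.prop.2, fun C hC hdisj ↦ ?_⟩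
  refine hF.le_of_ge ⟨?_, hF.prop.2.insert fun A hA _ ↦ hdisj A hA⟩ (Set.subset_insert C F)
    (Set.mem_insert C F)
  exact Set.forall_mem_insert.2 ⟨hC, hF.prop.1⟩

open scoped Function

namespace POVM

section Basic

variable {X : Type*} [MeasurableSpace X]
variable {H : Type*} [NormedAddCommGroup H] [InnerProductSpace ℂ H]
variable {μ ν : POVM X H} {A B : Set X}

theorem ext_of_measurableSet (h : ∀ A, MeasurableSet A → μ A = ν A) : μ = ν := by
  ext1
  funext A
  by_cases hA : MeasurableSet A
  · exact h A hA
  · rw [μ.not_measurable' A hA, ν.not_measurable' A hA]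

theorem nonneg (μ : POVM X H) (hA : MeasurableSet A) : 0 ≤ μ A :=
  (ContinuousLinearMap.nonneg_iff_isPositive _).2 (μ.isPositive' A hA)

theorem empty (μ : POVM X H) : μ ∅ = 0 := by
  ext k
  refine ext_inner_left ℂ fun h ↦ ?_
  obtain ⟨m, hm⟩ := μ.isComplexMeasure' h k
  rw [← hm _ .empty, m.empty, zero_apply, inner_zero_right]

theorem union (μ : POVM X H) (hA : MeasurableSet A) (hB : MeasurableSet B) (h : Disjoint A B) :
    μ (A ∪ B) = μ A + μ B := by
  ext k
  refine ext_inner_left ℂ fun x ↦ ?_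
  obtain ⟨m, hm⟩ := μ.isComplexMeasure' x k
  rw [← hm _ (hA.union hB), add_apply, inner_add_right, ← hm _ hA, ← hm _ hB]
  exact m.of_union h hA hB

theorem inter_add_diff (μ : POVM X H) (hA : MeasurableSet A) (hB : MeasurableSet B) :
    μ (A ∩ B) + μ (A \ B) = μ A := by
  rw [← μ.union (hA.inter hB) (hA.diff hB) Set.disjoint_sdiff_inter.symm, Set.inter_union_sdiff]

theorem hasSum_inner (μ : POVM X H) {ι : Type*} [Countable ι] {f : ι → Set X}
    (hf : ∀ i, MeasurableSet (f i)) (hd : Pairwise (Disjoint on f)) (h k : H) :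
    HasSum (fun i ↦ inner ℂ h (μ (f i) k)) (inner ℂ h (μ (⋃ i, f i) k)) := by
  obtain ⟨m, hm⟩ := μ.isComplexMeasure' h k
  simp only [← hm _ (hf _), ← hm _ (MeasurableSet.iUnion hf)]
  exact m.hasSum_of_disjoint_iUnion hf hd

theorem IsNormalized.apply_compl (hμ : μ.IsNormalized) (hA : MeasurableSet A) :
    μ Aᶜ = 1 - μ A := by
  rw [eq_sub_iff_add_eq', ← μ.union hA hA.compl disjoint_compl_right, Set.union_compl_self]
  exact hμ

theorem IsNormalized.apply_compl_eq_zero_iff (hμ : μ.IsNormalized) (hA : MeasurableSet A) :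
    μ Aᶜ = 0 ↔ μ A = 1 := by
  rw [hμ.apply_compl hA, sub_eq_zero, eq_comm]

theorem IsAtom.of_subset (hA : μ.IsAtom A) (hB : MeasurableSet B) (h : B ⊆ A) (h0 : μ B ≠ 0) :
    μ.IsAtom B := by
  have hBA : μ B = μ A := (hA.2.2 B hB h).resolve_left h0
  exact ⟨hB, h0, fun C hC hCB ↦ hBA ▸ hA.2.2 C hC (hCB.trans h)⟩

theorem IsAtom.exists_expectation (hA : μ.IsAtom A) :
    ∃ h : H, inner ℂ h (μ A h) = 1 ∧
      ∀ B, MeasurableSet B → inner ℂ h (μ (B ∩ A) h) • μ A = μ (B ∩ A) := by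
  have hpos := μ.isPositive' A hA.1
  obtain ⟨k, hk⟩ : ∃ k, inner ℂ k (μ A k) ≠ 0 := by
    by_contra! h
    refine hA.2.1 (ContinuousLinearMap.coe_injective ((inner_map_self_eq_zero _).1 fun k ↦ ?_))
    exact (hpos.inner_left_eq_inner_right k k).trans (h k)
  obtain ⟨r, hr, hrk⟩ : ∃ r : ℝ, 0 ≤ r ∧ (r : ℂ) = inner ℂ k (μ A k) :=
    RCLike.nonneg_iff_exists_ofReal.1 (hpos.inner_nonneg_right k)
  have hr₀ : (√r : ℂ) ≠ 0 := fun h ↦ hk <| by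
    rw [← hrk, ← Real.mul_self_sqrt hr, Complex.ofReal_mul, h, mul_zero]
  have hone : inner ℂ ((√r : ℂ)⁻¹ • k) (μ A ((√r : ℂ)⁻¹ • k)) = 1 := by
    rw [map_smul, inner_smul_left, inner_smul_right, ← hrk, map_inv₀, Complex.conj_ofReal,
      ← Real.mul_self_sqrt hr, Complex.ofReal_mul, Real.mul_self_sqrt hr]
    field_simp
  refine ⟨(√r : ℂ)⁻¹ • k, hone, fun B hB ↦ ?_⟩
  rcases hA.2.2 _ (hB.inter hA.1) Set.inter_subset_right with h | h
  · rw [h, zero_apply, inner_zero_right, zero_smul]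
  · rw [h, hone, one_smul]

end Basic

section Order

variable {X : Type*} [MeasurableSpace X]
variable {H : Type*} [NormedAddCommGroup H] [InnerProductSpace ℂ H] [CompleteSpace H]
variable {μ : POVM X H} {A B : Set X}

theorem mono (μ : POVM X H) (hA : MeasurableSet A) (hB : MeasurableSet B) (h : A ⊆ B) :
    μ A ≤ μ B := by
  rw [← μ.inter_add_diff hB hA, Set.inter_eq_self_of_subset_right h]
  exact le_add_of_nonneg_right (μ.nonneg (hB.diff hA))

theorem apply_eq_zero_of_subset (hA : MeasurableSet A) (hB : MeasurableSet B) (h : A ⊆ B)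
    (h0 : μ B = 0) : μ A = 0 :=
  le_antisymm (h0 ▸ μ.mono hA hB h) (μ.nonneg hA)

theorem apply_inter_eq (hA : MeasurableSet A) (hB : MeasurableSet B) (h : μ Bᶜ = 0) :
    μ (A ∩ B) = μ A := by
  rw [← μ.inter_add_diff hA hB,
    apply_eq_zero_of_subset (hA.diff hB) hB.compl (Set.sdiff_subset_compl A B) h, add_zero]

theorem mutuallySingular_iff {K : Type*} [NormedAddCommGroup K] [InnerProductSpace ℂ K]
    [CompleteSpace K] {ν : POVM X K} :
    MutuallySingular μ ν ↔ ∃ E, MeasurableSet E ∧ μ Eᶜ = 0 ∧ ν E = 0 := by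
  constructor
  · rintro ⟨X₁, X₂, h₁, -, hd, hμ, hν⟩
    refine ⟨X₁, h₁, ?_, ?_⟩
    · rw [hμ _ h₁.compl, Set.compl_inter_self, μ.empty]
    · rw [hν _ h₁, hd.inter_eq, ν.empty]
  · rintro ⟨E, hE, hμ, hν⟩
    exact ⟨E, Eᶜ, hE, hE.compl, disjoint_compl_right, fun A hA ↦ (apply_inter_eq hA hE hμ).symm,
      fun A hA ↦ (apply_inter_eq hA hE.compl (by rwa [compl_compl])).symm⟩

theorem IsNormalized.mul_eq_apply_inter (hμ : μ.IsNormalized) (hA : MeasurableSet A)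
    (hP : IsStarProjection (μ A)) (hB : MeasurableSet B) :
    μ A * μ B = μ (B ∩ A) ∧ μ B * μ A = μ (B ∩ A) := by
  have hin := hP.mul_right_and_mul_left_of_nonneg_of_le (μ.nonneg (hB.inter hA))
    (μ.mono (hB.inter hA) hA Set.inter_subset_right)
  have hout := hP.one_sub.mul_right_and_mul_left_of_nonneg_of_le (μ.nonneg (hB.diff hA))
    (hμ.apply_compl hA ▸ μ.mono (hB.diff hA) hA.compl (Set.sdiff_subset_compl B A))
  rw [mul_sub, mul_one, sub_eq_self, sub_mul, one_mul, sub_eq_self] at hout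
  rw [← μ.inter_add_diff hB hA, mul_add, add_mul, hin.1, hin.2, hout.1, hout.2, add_zero]
  exact ⟨rfl, rfl⟩

theorem IsNormalized.isStarProjection_iUnion (hμ : μ.IsNormalized) {ι : Type*} [Countable ι]
    {f : ι → Set X} (hf : ∀ i, MeasurableSet (f i)) (hd : Pairwise (Disjoint on f))
    (hP : ∀ i, IsStarProjection (μ (f i))) : IsStarProjection (μ (⋃ i, f i)) := by
  have hU := MeasurableSet.iUnion hf
  have hsa : IsSelfAdjoint (μ (⋃ i, f i)) := .of_nonneg (μ.nonneg hU)
  have habsorb : ∀ i, μ (⋃ i, f i) * μ (f i) = μ (f i) := fun i ↦ by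
    rw [(hμ.mul_eq_apply_inter (hf i) (hP i) hU).2,
      Set.inter_eq_self_of_subset_right (Set.subset_iUnion f i)]
  have hterm : ∀ (h k : H) i, inner ℂ (μ (⋃ i, f i) h) (μ (f i) k) = inner ℂ h (μ (f i) k) :=
    fun h k i ↦ by
      conv_rhs => rw [← habsorb i]
      exact hsa.isSymmetric h (μ (f i) k)
  refine ⟨?_, hsa⟩
  ext k
  refine ext_inner_left ℂ fun h ↦ ?_
  calc inner ℂ h (μ (⋃ i, f i) (μ (⋃ i, f i) k)) = inner ℂ (μ (⋃ i, f i) h) (μ (⋃ i, f i) k) :=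
        (hsa.isSymmetric h _).symm
    _ = inner ℂ h (μ (⋃ i, f i) k) := by
        refine (μ.hasSum_inner hf hd _ k).unique ?_
        simpa only [hterm] using μ.hasSum_inner hf hd h k

theorem IsNormalized.countable_of_pairwiseDisjoint [TopologicalSpace.SeparableSpace H]
    (hμ : μ.IsNormalized) {S : Set (Set X)} (hd : S.PairwiseDisjoint id)
    (hS : ∀ A ∈ S, MeasurableSet A ∧ μ A ≠ 0 ∧ IsStarProjection (μ A)) : S.Countable := by
  have hne : ∀ A : S, ∃ v, μ A v ≠ 0 := fun A ↦ by
    by_contra! h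
    exact (hS A A.2).2.1 (ContinuousLinearMap.ext h)
  choose v hv using hne
  refine Set.countable_coe_iff.1 (countable_of_pairwise_inner_eq_zero (𝕜 := ℂ) hv fun A B hAB ↦ ?_)
  obtain ⟨hA, -, hP⟩ := hS A A.2
  have hdisj : Disjoint (B : Set X) A := hd B.2 A.2 (Subtype.coe_ne_coe.2 hAB.symm)
  have hmul : μ A * μ B = 0 := by
    rw [(hμ.mul_eq_apply_inter hA hP (hS B B.2).1).1, hdisj.inter_eq, μ.empty]
  calc inner ℂ (μ A (v A)) (μ B (v B)) = inner ℂ (v A) ((μ A * μ B) (v B)) :=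
        (μ.isPositive' A hA).inner_left_eq_inner_right _ _
    _ = 0 := by rw [hmul, zero_apply, inner_zero_right]

end Order

section Constructions

variable {X : Type*} [MeasurableSpace X]
variable {H : Type*} [NormedAddCommGroup H] [InnerProductSpace ℂ H]
variable {K : Type*} [NormedAddCommGroup K] [InnerProductSpace ℂ K]
variable {A B : Set X}

instance : Add (POVM X H) where
  add μ ν :=
    { toFun B := μ B + ν B
      isPositive' B hB := (μ.isPositive' B hB).add (ν.isPositive' B hB)
      isComplexMeasure' h k := by
        obtain ⟨m, hm⟩ := μ.isComplexMeasure' h k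
        obtain ⟨n, hn⟩ := ν.isComplexMeasure' h k
        refine ⟨m + n, fun B hB ↦ ?_⟩
        rw [add_apply, add_apply, inner_add_right, hm B hB, hn B hB]
      not_measurable' B hB := by rw [μ.not_measurable' B hB, ν.not_measurable' B hB, add_zero] }

theorem add_apply (μ ν : POVM X H) (B : Set X) : (μ + ν) B = μ B + ν B := rfl

open Classical in
/-- The restriction `B ↦ μ(B ∩ A)` of `μ` to a measurable set `A`, as a POVM on the whole of `X`. -/
noncomputable def restrict (μ : POVM X H) (hA : MeasurableSet A) : POVM X H where
  toFun B := if MeasurableSet B then μ (B ∩ A) else 0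
  isPositive' B hB := by
    rw [if_pos hB]
    exact μ.isPositive' _ (hB.inter hA)
  isComplexMeasure' h k := by
    obtain ⟨m, hm⟩ := μ.isComplexMeasure' h k
    refine ⟨m.restrict A, fun B hB ↦ ?_⟩
    rw [if_pos hB, MeasureTheory.VectorMeasure.restrict_apply _ hA hB, hm _ (hB.inter hA)]
  not_measurable' _ hB := if_neg hB

theorem restrict_apply (μ : POVM X H) (hA : MeasurableSet A) (hB : MeasurableSet B) :
    μ.restrict hA B = μ (B ∩ A) :=
  if_pos hB

open scoped ComplexOrder in
/-- The product `B ↦ ⟨h, μ(B) h⟩ G` of the scalar measure given by the expectation of `μ` at the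
vector `h` and a fixed positive operator `G`. -/
noncomputable def expectationSMul (μ : POVM X H) (h : H) {G : K →L[ℂ] K} (hG : G.IsPositive) :
    POVM X K where
  toFun B := inner ℂ h (μ B h) • G
  isPositive' B hB := hG.smul_of_nonneg ((μ.isPositive' B hB).inner_nonneg_right h)
  isComplexMeasure' x y := by
    obtain ⟨m, hm⟩ := μ.isComplexMeasure' h h
    refine ⟨inner ℂ x (G y) • m, fun B hB ↦ ?_⟩
    rw [smul_apply, smul_apply, inner_smul_right, hm B hB, smul_eq_mul, mul_comm]
  not_measurable' B hB := by rw [μ.not_measurable' B hB, zero_apply, inner_zero_right, zero_smul]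

theorem expectationSMul_apply (μ : POVM X H) (h : H) {G : K →L[ℂ] K} (hG : G.IsPositive)
    (B : Set X) : μ.expectationSMul h hG B = inner ℂ h (μ B h) • G := rfl

variable [CompleteSpace H] [CompleteSpace K]

/-- The POVM `B ↦ S* μ(B) S`. For the inclusion `S` of a closed subspace this is the compression of
`μ` to that subspace; for an orthogonal projection onto a closed subspace it is the extension of
`μ` by zero. -/
noncomputable def conj (μ : POVM X H) (S : K →L[ℂ] H) : POVM X K where
  toFun B := S.adjoint ∘L μ B ∘L S
  isPositive' B hB := (μ.isPositive' B hB).adjoint_conj S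
  isComplexMeasure' h k := by
    obtain ⟨m, hm⟩ := μ.isComplexMeasure' (S h) (S k)
    refine ⟨m, fun B hB ↦ ?_⟩
    rw [hm B hB, ContinuousLinearMap.comp_apply, ContinuousLinearMap.adjoint_inner_right,
      ContinuousLinearMap.comp_apply]
  not_measurable' B hB := by
    rw [μ.not_measurable' B hB, ContinuousLinearMap.zero_comp, ContinuousLinearMap.comp_zero]

theorem conj_apply_apply (μ : POVM X H) (S : K →L[ℂ] H) (B : Set X) (k : K) :
    μ.conj S B k = S.adjoint (μ B (S k)) := rfl

theorem conj_apply (μ : POVM X H) (S : H →L[ℂ] H) (B : Set X) :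
    μ.conj S B = star S * μ B * S :=
  (mul_assoc _ _ _).symm

theorem conj_conj (μ : POVM X H) (S R : H →L[ℂ] H) : (μ.conj S).conj R = μ.conj (S * R) :=
  ext_of_measurableSet fun B _ ↦ by simp only [conj_apply, star_mul, mul_assoc]

theorem conj_one (μ : POVM X H) : μ.conj (1 : H →L[ℂ] H) = μ :=
  ext_of_measurableSet fun B _ ↦ by rw [conj_apply, star_one, one_mul, mul_one]

theorem unitarilyEquivalent_iff {μ ν : POVM X H} :
    ν.UnitarilyEquivalent μ ↔ ∃ U ∈ unitary (H →L[ℂ] H), ν = μ.conj U := by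
  constructor
  · rintro ⟨U, hU, h⟩
    exact ⟨U, hU, ext_of_measurableSet fun B hB ↦ (h B hB).trans (μ.conj_apply U B).symm⟩
  · rintro ⟨U, hU, rfl⟩
    exact ⟨U, hU, fun B _ ↦ μ.conj_apply U B⟩

theorem isNormalized_conj_inv {μ : POVM X H} {R : (H →L[ℂ] H)ˣ}
    (h : μ Set.univ = star (R : H →L[ℂ] H) * R) : (μ.conj (↑R⁻¹ : H →L[ℂ] H)).IsNormalized := by
  rw [IsNormalized, conj_apply, h, ← mul_assoc, ← star_mul, Units.mul_inv, star_one, one_mul,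
    Units.mul_inv]

theorem IsCStarExtreme.exists_eq_conj {μ : POVM X H} (hμ : μ.IsCStarExtreme) {n : ℕ}
    {ν : Fin n → POVM X H} (hν : ∀ i, IsUnit (ν i Set.univ)) {w : Fin n → ℝ} (hw : ∀ i, 0 < w i)
    (h : ∀ B, MeasurableSet B → μ B = ∑ i, w i • ν i B) (i : Fin n) :
    ∃ S : H →L[ℂ] H, IsUnit S ∧ ν i = μ.conj S := by
  choose R hR hνR using fun i ↦ CStarAlgebra.isStrictlyPositive_iff_eq_star_mul_self.1
    ((hν i).isStrictlyPositive ((ν i).nonneg .univ))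
  choose r hr using fun i ↦ hR i
  have hconj : ∀ i, ((ν i).conj ↑(r i)⁻¹).conj (R i) = ν i := fun i ↦ by
    rw [conj_conj, ← hr, Units.inv_mul, conj_one]
  have hcomb : μ.IsProperCStarCombination (fun i ↦ (ν i).conj ↑(r i)⁻¹)
      (fun i ↦ √(w i) • R i) := by
    refine ⟨fun i ↦ ?_, fun i ↦ ?_, ?_, fun B hB ↦ ?_⟩
    · exact isNormalized_conj_inv (by rw [hνR, hr])
    · exact (hR i).smul (Units.mk0 _ (Real.sqrt_pos.2 (hw i)).ne')
    · calc ∑ i, star (√(w i) • R i) * (√(w i) • R i) = ∑ i, w i • ν i Set.univ :=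
            Finset.sum_congr rfl fun i _ ↦ by
              rw [hνR, ← mul_one (star (√(w i) • R i)), star_sqrt_smul_mul_mul (hw i).le, mul_one]
        _ = 1 := (h _ .univ).symm.trans hμ.1
    · refine (h B hB).trans (Finset.sum_congr rfl fun i _ ↦ ?_)
      rw [star_sqrt_smul_mul_mul (hw i).le, ← conj_apply, hconj]
  obtain ⟨U, hUu, hU⟩ := unitarilyEquivalent_iff.1 (hμ.2 n _ _ hcomb i)
  refine ⟨U * R i, (Unitary.isUnit_coe (U := ⟨U, hUu⟩)).mul (hR i), ?_⟩
  rw [← conj_conj, ← hU, hconj]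

end Constructions

section Atom

variable {X : Type*} [MeasurableSpace X]
variable {H : Type*} [NormedAddCommGroup H] [InnerProductSpace ℂ H]
variable {μ : POVM X H} {A B : Set X}

/-- Replace `μ` on the measurable set `A` by the product `⟨h, μ(·) h⟩ G`. If `A` is an atom of `μ`
and `⟨h, μ(A) h⟩ = 1`, this only changes the value at the atom, from `μ(A)` to `G`. -/
noncomputable def replaceOn (μ : POVM X H) (hA : MeasurableSet A) (h : H) {G : H →L[ℂ] H}
    (hG : G.IsPositive) : POVM X H :=
  μ.restrict hA.compl + (μ.restrict hA).expectationSMul h hG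

theorem replaceOn_apply (μ : POVM X H) (hA : MeasurableSet A) (h : H) {G : H →L[ℂ] H}
    (hG : G.IsPositive) (hB : MeasurableSet B) :
    μ.replaceOn hA h hG B = μ (B \ A) + inner ℂ h (μ (B ∩ A) h) • G := by
  rw [replaceOn, add_apply, expectationSMul_apply, restrict_apply _ _ hB, restrict_apply _ _ hB,
    Set.sdiff_eq]

theorem replaceOn_apply_self (μ : POVM X H) (hA : MeasurableSet A) {h : H}
    (hone : inner ℂ h (μ A h) = 1) {G : H →L[ℂ] H} (hG : G.IsPositive) :
    μ.replaceOn hA h hG A = G := by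
  rw [replaceOn_apply _ _ _ _ hA, Set.sdiff_self, μ.empty, Set.inter_self, hone, one_smul, zero_add]

theorem replaceOn_apply_univ (μ : POVM X H) (hA : MeasurableSet A) {h : H}
    (hone : inner ℂ h (μ A h) = 1) {G : H →L[ℂ] H} (hG : G.IsPositive) :
    μ.replaceOn hA h hG Set.univ = μ Aᶜ + G := by
  rw [replaceOn_apply _ _ _ _ .univ, ← Set.compl_eq_univ_sdiff, Set.univ_inter, hone, one_smul]

variable [CompleteSpace H]

theorem IsCStarExtreme.exists_congruence_of_isAtom (hμ : μ.IsCStarExtreme) (hA : μ.IsAtom A)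
    {D : H →L[ℂ] H} (hD : -μ A ≤ D) (hD' : D ≤ μ A) (hnorm : ‖D‖ < 1) :
    ∃ S : H →L[ℂ] H, IsUnit S ∧ star S * S = 1 + D ∧ star S * μ A * S = μ A + D := by
  obtain ⟨h, hone, hsmul⟩ := hA.exists_expectation
  have hadd : (μ A + D).IsPositive :=
    (ContinuousLinearMap.nonneg_iff_isPositive _).1 (neg_le_iff_add_nonneg'.1 hD)
  have hsub : (μ A - D).IsPositive :=
    (ContinuousLinearMap.nonneg_iff_isPositive _).1 (sub_nonneg.2 hD')
  let ν : Fin 2 → POVM X H := ![μ.replaceOn hA.1 h hadd, μ.replaceOn hA.1 h hsub]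
  have huniv : ν 0 Set.univ = 1 + D ∧ ν 1 Set.univ = 1 - D := by
    constructor <;> refine (μ.replaceOn_apply_univ hA.1 hone _).trans ?_ <;>
      rw [hμ.1.apply_compl hA.1] <;> abel
  have hunit : ∀ i, IsUnit (ν i Set.univ) := by
    refine Fin.forall_fin_two.2 ⟨?_, huniv.2 ▸ isUnit_one_sub_of_norm_lt_one hnorm⟩
    rw [huniv.1, ← sub_neg_eq_add]
    exact isUnit_one_sub_of_norm_lt_one (norm_neg D ▸ hnorm)
  have hsum : ∀ B, MeasurableSet B → μ B = ∑ i, (1 / 2 : ℝ) • ν i B := fun B hB ↦ by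
    calc μ B = (1 / 2 : ℝ) • (μ B + μ B) := by
          rw [← two_smul ℝ, smul_smul, one_div, inv_mul_cancel₀ two_ne_zero, one_smul]
      _ = (1 / 2 : ℝ) • (ν 0 B + ν 1 B) := by
          simp only [ν, Matrix.cons_val_zero, Matrix.cons_val_one, replaceOn_apply _ _ _ _ hB,
            smul_add, smul_sub, hsmul B hB, ← μ.inter_add_diff hB hA.1]
          abel_nf
      _ = ∑ i, (1 / 2 : ℝ) • ν i B := by rw [Fin.sum_univ_two, smul_add]
  obtain ⟨S, hSu, hS⟩ := hμ.exists_eq_conj hunit (fun _ ↦ one_half_pos) hsum 0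
  refine ⟨S, hSu, ?_, ?_⟩
  · rw [← huniv.1, hS, conj_apply, hμ.1, mul_one]
  · rw [← conj_apply, ← hS]
    exact μ.replaceOn_apply_self hA.1 hone hadd

theorem IsCStarExtreme.isStarProjection_of_isAtom [TopologicalSpace.SeparableSpace H]
    (hμ : μ.IsCStarExtreme) (hA : μ.IsAtom A) : IsStarProjection (μ A) := by
  have hnonneg := μ.nonneg hA.1
  have hsa : IsSelfAdjoint (μ A) := .of_nonneg hnonneg
  refine isStarProjection_iff_spectrum_subset_and_isSelfAdjoint.2 ⟨fun x₀ hx₀ ↦ ?_, hsa⟩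
  by_contra hx
  obtain ⟨hx_zero, hx_one⟩ : x₀ ≠ 0 ∧ x₀ ≠ 1 := not_or.1 hx
  have hpos : 0 < x₀ := (spectrum_nonneg_of_nonneg hnonneg hx₀).lt_of_ne' hx_zero
  have heigen : ∀ᶠ c : ℝ in nhds x₀, Module.End.HasEigenvalue (μ A : H →ₗ[ℂ] H) (c : ℂ) := by
    filter_upwards [eventually_exists_add_apply_eq_smul hnonneg hx₀ hpos hx_one]
      with c ⟨D, hD, hD', hnorm, v, hv, hpencil⟩
    obtain ⟨S, hSu, hS, hSA⟩ := hμ.exists_congruence_of_isAtom hA hD hD' hnorm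
    exact hasEigenvalue_of_star_mul_mul_apply_eq_smul hSu hv (by rw [hSA, hS, hpencil])
  have hcountable : {c : ℝ | Module.End.HasEigenvalue (μ A : H →ₗ[ℂ] H) (c : ℂ)}.Countable :=
    (countable_setOf_hasEigenvalue hsa.isSymmetric).preimage Complex.ofReal_injective
  have hinterior := interior_eq_empty_iff_dense_compl.2 (hcountable.dense_compl ℝ)
  exact Set.notMem_empty x₀ (hinterior ▸ mem_interior_iff_mem_nhds.2 heigen)

end Atom

section AtomicPart

variable {X : Type*} [MeasurableSpace X]
variable {H : Type*} [NormedAddCommGroup H] [InnerProductSpace ℂ H]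

theorem exists_apply_ne_zero_of_iUnion (μ : POVM X H) {ι : Type*} [Countable ι] {f : ι → Set X}
    (hf : ∀ i, MeasurableSet (f i)) (hd : Pairwise (Disjoint on f)) (h : μ (⋃ i, f i) ≠ 0) :
    ∃ i, μ (f i) ≠ 0 := by
  contrapose! h
  ext k
  refine ext_inner_left ℂ fun x ↦ (μ.hasSum_inner hf hd x k).unique ?_
  simpa only [h, zero_apply, inner_zero_right] using hasSum_zero

variable [CompleteSpace H] [TopologicalSpace.SeparableSpace H] {μ : POVM X H}

theorem IsCStarExtreme.exists_subset_exhausting_atoms (hμ : μ.IsCStarExtreme)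
    (B : Set X) :
    ∃ E ⊆ B, MeasurableSet E ∧ IsStarProjection (μ E) ∧
      (∀ C ⊆ E, MeasurableSet C → μ C ≠ 0 → ∃ D ⊆ C, μ.IsAtom D) ∧
        ∀ C ⊆ B \ E, ¬ μ.IsAtom C := by
  obtain ⟨F, hF, hdisj, hmax⟩ := exists_maximal_pairwiseDisjoint fun A ↦ μ.IsAtom A ∧ A ⊆ B
  have hproj : ∀ A ∈ F, IsStarProjection (μ A) := fun A hA ↦
    hμ.isStarProjection_of_isAtom (hF A hA).1
  have : Countable F := (hμ.1.countable_of_pairwiseDisjoint hdisj fun A hA ↦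
    ⟨(hF A hA).1.1, (hF A hA).1.2.1, hproj A hA⟩).to_subtype
  have hmeas : ∀ A : F, MeasurableSet (A : Set X) := fun A ↦ (hF A A.2).1.1
  have hdisj' : Pairwise (Disjoint on fun A : F ↦ (A : Set X)) := fun A A' h ↦
    hdisj A.2 A'.2 (Subtype.coe_ne_coe.2 h)
  refine ⟨⋃ A : F, A, Set.iUnion_subset fun A ↦ (hF A A.2).2, .iUnion hmeas,
    hμ.1.isStarProjection_iUnion hmeas hdisj' fun A ↦ hproj A A.2, fun C hCE hC hne ↦ ?_,
    fun C hCE hC ↦ ?_⟩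
  · rw [← Set.inter_eq_self_of_subset_left hCE, Set.inter_iUnion] at hne
    obtain ⟨A, hA⟩ := exists_apply_ne_zero_of_iUnion μ (fun A ↦ hC.inter (hmeas A))
      (fun A A' h ↦ (hdisj' h).mono Set.inter_subset_right Set.inter_subset_right) hne
    exact ⟨C ∩ A, Set.inter_subset_left,
      (hF A A.2).1.of_subset (hC.inter (hmeas A)) Set.inter_subset_right hA⟩
  · have hCdisj : Disjoint C (⋃ A : F, A) := Set.disjoint_of_subset_left hCE Set.disjoint_sdiff_left
    have hCF : C ∈ F := hmax C ⟨hC, hCE.trans Set.sdiff_subset⟩ fun A hA ↦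
      hCdisj.mono_right (Set.subset_iUnion (fun A : F ↦ (A : Set X)) ⟨A, hA⟩)
    have hCempty : C = ∅ :=
      hCdisj.eq_bot_of_le (Set.subset_iUnion (fun A : F ↦ (A : Set X)) ⟨C, hCF⟩)
    exact hC.2.1 (hCempty ▸ μ.empty)

theorem IsCStarExtreme.isSpectral_of_isAtomic (hμ : μ.IsCStarExtreme) (hatomic : μ.IsAtomic) :
    μ.IsSpectral := by
  refine ⟨hμ.1, fun B hB ↦ ?_⟩
  obtain ⟨E, hEB, hE, hproj, -, hnone⟩ := hμ.exists_subset_exhausting_atoms B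
  have hdiff : μ (B \ E) = 0 := by
    by_contra hne
    obtain ⟨C, hC, hatom⟩ := hatomic _ (hB.diff hE) hne
    exact hnone C hC hatom
  rwa [← μ.inter_add_diff hB hE, hdiff, add_zero, Set.inter_eq_self_of_subset_right hEB]

end AtomicPart

namespace DirectSumDecomposition

section Summands

variable {X : Type*} [MeasurableSpace X]
variable {H : Type*} [NormedAddCommGroup H] [InnerProductSpace ℂ H] [CompleteSpace H]
variable {μ : POVM X H} (d : μ.DirectSumDecomposition) {A B : Set X}

/-- The decomposition with its two summands exchanged. It transfers statements about the first
summand to the second one. -/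
def swap : μ.DirectSumDecomposition where
  K₁ := d.K₂
  K₂ := d.K₁
  orthogonal_eq := by
    rw [d.orthogonal_eq]
    exact ClosedSubmodule.toSubmodule_injective d.K₁.toSubmodule.orthogonal_orthogonal.symm
  μ₁ := d.μ₂
  μ₂ := d.μ₁
  eq_directSum A hA x y := by rw [add_comm, d.eq_directSum A hA, add_comm]

omit [CompleteSpace H] in
theorem toSubmodule_K₂ : d.K₂.toSubmodule = d.K₁.toSubmoduleᗮ := by
  rw [d.orthogonal_eq]
  rfl

theorem exists_eq_add (z : H) :
    ∃ (x : d.K₁.toSubmodule) (y : d.K₂.toSubmodule), z = (x : H) + (y : H) := by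
  obtain ⟨x, hx, y, hy, h⟩ := d.K₁.toSubmodule.exists_add_mem_mem_orthogonal z
  exact ⟨⟨x, hx⟩, ⟨y, d.toSubmodule_K₂ ▸ hy⟩, h⟩

omit [CompleteSpace H] in
theorem apply_left (hA : MeasurableSet A) (x : d.K₁.toSubmodule) : μ A x = d.μ₁ A x := by
  simpa using d.eq_directSum A hA x 0

theorem apply_right (hA : MeasurableSet A) (y : d.K₂.toSubmodule) : μ A y = d.μ₂ A y :=
  d.swap.apply_left hA y

omit [CompleteSpace H] in
theorem isNormalized_left (hμ : μ.IsNormalized) : d.μ₁.IsNormalized := by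
  ext x
  rw [← d.apply_left .univ, hμ]
  rfl

theorem isNormalized_right (hμ : μ.IsNormalized) : d.μ₂.IsNormalized :=
  d.swap.isNormalized_left hμ

theorem apply_eq_apply_iff (hA : MeasurableSet A) (hB : MeasurableSet B) :
    μ A = μ B ↔ d.μ₁ A = d.μ₁ B ∧ d.μ₂ A = d.μ₂ B := by
  refine ⟨fun h ↦ ⟨?_, ?_⟩, fun h ↦ ?_⟩
  · ext x
    rw [← d.apply_left hA, ← d.apply_left hB, h]
  · ext y
    rw [← d.apply_right hA, ← d.apply_right hB, h]
  · ext z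
    obtain ⟨x, y, rfl⟩ := d.exists_eq_add z
    rw [d.eq_directSum A hA, d.eq_directSum B hB, h.1, h.2]

theorem apply_eq_zero_iff (hA : MeasurableSet A) : μ A = 0 ↔ d.μ₁ A = 0 ∧ d.μ₂ A = 0 := by
  simpa only [POVM.empty] using d.apply_eq_apply_iff hA .empty

theorem isAtom_iff_left (hA : MeasurableSet A) (h : d.μ₂ A = 0) :
    μ.IsAtom A ↔ d.μ₁.IsAtom A := by
  refine and_congr_right fun _ ↦ and_congr (not_congr ?_) (forall₃_congr fun B hB hBA ↦ ?_)
  · rw [d.apply_eq_zero_iff hA, and_iff_left h]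
  · rw [d.apply_eq_zero_iff hB, d.apply_eq_apply_iff hB hA, h, apply_eq_zero_of_subset hB hA hBA h,
      and_iff_left rfl, and_iff_left rfl]

theorem isAtom_iff_right (hA : MeasurableSet A) (h : d.μ₁ A = 0) :
    μ.IsAtom A ↔ d.μ₂.IsAtom A :=
  d.swap.isAtom_iff_left hA h

theorem ext_of_left {d d' : μ.DirectSumDecomposition} (h : d.K₁ = d'.K₁) : d = d' := by
  have hleft := fun A hA ↦ d.apply_left (A := A) hA
  have hright := fun A hA ↦ d.apply_right (A := A) hA
  have hleft' := fun A hA ↦ d'.apply_left (A := A) hA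
  have hright' := fun A hA ↦ d'.apply_right (A := A) hA
  obtain ⟨K₁, K₂, hK, μ₁, μ₂, hd⟩ := d
  obtain ⟨K₁', K₂', hK', μ₁', μ₂', hd'⟩ := d'
  dsimp only at h hleft hright hleft' hright'
  subst h hK hK'
  congr 1
  · refine ext_of_measurableSet fun A hA ↦ ?_
    ext x
    rw [← hleft A hA, ← hleft' A hA]
  · refine ext_of_measurableSet fun A hA ↦ ?_
    ext y
    rw [← hright A hA, ← hright' A hA]

end Summands

end DirectSumDecomposition

section Splitting

variable {X : Type*} [MeasurableSpace X]
variable {H : Type*} [NormedAddCommGroup H] [InnerProductSpace ℂ H] [CompleteSpace H]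
variable {μ : POVM X H}

/-- The decomposition of `μ` along a closed subspace `K` and its orthogonal complement, when the
projection onto `K` commutes with `μ`; the summands are the compressions of `μ`. -/
noncomputable def DirectSumDecomposition.ofCommute (K : ClosedSubmodule ℂ H)
    (hK : ∀ A, MeasurableSet A → Commute K.toSubmodule.starProjection (μ A)) :
    μ.DirectSumDecomposition where
  K₁ := K
  K₂ := Kᗮ
  orthogonal_eq := rfl
  μ₁ := μ.conj K.toSubmodule.subtypeL
  μ₂ := μ.conj Kᗮ.toSubmodule.subtypeL
  eq_directSum A hA x y := by
    have hcompress : ∀ (L : ClosedSubmodule ℂ H), Commute L.toSubmodule.starProjection (μ A) →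
        ∀ z : L.toSubmodule, (μ.conj L.toSubmodule.subtypeL A z : H) = μ A z := fun L hL z ↦ by
      rw [conj_apply_apply, Submodule.adjoint_subtypeL]
      change L.toSubmodule.starProjection (μ A z) = μ A z
      rw [← mul_apply_eq_comp, hL.eq, mul_apply_eq_comp, Submodule.starProjection_eq_self_iff.2 z.2]
    have hK' : Commute Kᗮ.toSubmodule.starProjection (μ A) := by
      change Commute K.toSubmoduleᗮ.starProjection (μ A)
      rw [Submodule.starProjection_orthogonal']
      exact (Commute.one_left _).sub_left (hK A hA)
    rw [hcompress K (hK A hA), hcompress Kᗮ hK', map_add]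

theorem IsNormalized.exists_directSumDecomposition (hμ : μ.IsNormalized) {E : Set X}
    (hE : MeasurableSet E) (hP : IsStarProjection (μ E)) :
    ∃ d : μ.DirectSumDecomposition, d.μ₁ Eᶜ = 0 ∧ d.μ₂ E = 0 := by
  obtain ⟨K, _, hK⟩ := isStarProjection_iff_eq_starProjection.1 hP
  let L : ClosedSubmodule ℂ H :=
    ⟨K, K.range_starProjection ▸
      ContinuousLinearMap.IsIdempotentElem.isClosed_range K.isIdempotentElem_starProjection⟩
  let d := DirectSumDecomposition.ofCommute (μ := μ) L fun A hA ↦ by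
    obtain ⟨hleft, hright⟩ := hμ.mul_eq_apply_inter hE hP hA
    exact hK ▸ hleft.trans hright.symm
  refine ⟨d, ?_, ?_⟩
  · rw [(d.isNormalized_left hμ).apply_compl_eq_zero_iff hE]
    ext x
    rw [← d.apply_left hE, hK]
    exact Submodule.starProjection_eq_self_iff.2 x.2
  · ext y
    rw [← d.apply_right hE, hK]
    exact K.starProjection_apply_eq_zero_iff.2 y.2

theorem IsCStarExtreme.exists_isAtomicNonAtomic [TopologicalSpace.SeparableSpace H]
    (hμ : μ.IsCStarExtreme) : ∃ d : μ.DirectSumDecomposition, d.IsAtomicNonAtomic := by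
  obtain ⟨E, -, hE, hP, hatoms, hnone⟩ := hμ.exists_subset_exhausting_atoms Set.univ
  obtain ⟨d, hleft, hright⟩ := hμ.1.exists_directSumDecomposition hE hP
  refine ⟨d, d.isNormalized_left hμ.1, fun A hA hne ↦ ?_, d.isNormalized_right hμ.1,
    fun A hA ↦ ?_, mutuallySingular_iff.2 ⟨E, hE, hleft, hright⟩⟩
  · rw [← apply_inter_eq hA hE hleft] at hne
    obtain ⟨C, hCA, hC⟩ := hatoms (A ∩ E) Set.inter_subset_right (hA.inter hE)
      fun h ↦ hne ((d.apply_eq_zero_iff (hA.inter hE)).1 h).1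
    exact ⟨C, hCA.trans Set.inter_subset_left, (d.isAtom_iff_left hC.1 (apply_eq_zero_of_subset
      hC.1 hE (hCA.trans Set.inter_subset_right) hright)).1 hC⟩
  · have hmeas := hA.1.inter hE.compl
    have hatom : d.μ₂.IsAtom (A ∩ Eᶜ) := hA.of_subset hmeas Set.inter_subset_left
      (by rw [apply_inter_eq hA.1 hE.compl (by rwa [compl_compl])]; exact hA.2.1)
    exact hnone (A ∩ Eᶜ) (fun x hx ↦ ⟨Set.mem_univ x, hx.2⟩) ((d.isAtom_iff_right hmeas
      (apply_eq_zero_of_subset hmeas hE.compl Set.inter_subset_right hleft)).2 hatom)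

end Splitting

section Uniqueness

variable {X : Type*} [MeasurableSpace X]
variable {H : Type*} [NormedAddCommGroup H] [InnerProductSpace ℂ H] [CompleteSpace H]
variable {μ : POVM X H}

namespace DirectSumDecomposition

theorem apply_eq_starProjection (d : μ.DirectSumDecomposition) (hμ : μ.IsNormalized) {E : Set X}
    (hE : MeasurableSet E) (hleft : d.μ₁ Eᶜ = 0) (hright : d.μ₂ E = 0) :
    μ E = d.K₁.toSubmodule.starProjection := by
  ext z
  obtain ⟨x, y, rfl⟩ := d.exists_eq_add z
  have hy : (y : H) ∈ d.K₁.toSubmoduleᗮ := d.toSubmodule_K₂ ▸ y.2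
  rw [d.eq_directSum E hE, ((d.isNormalized_left hμ).apply_compl_eq_zero_iff hE).1 hleft, hright,
    map_add, Submodule.starProjection_eq_self_iff.2 x.2,
    (Submodule.starProjection_apply_eq_zero_iff _).2 hy]
  rfl

theorem apply_diff_eq_zero {d d' : μ.DirectSumDecomposition} (hatomic : d.μ₁.IsAtomic)
    (hnonatomic : d'.μ₂.IsNonAtomic) {E E' : Set X} (hE : MeasurableSet E)
    (hE' : MeasurableSet E') (hright : d.μ₂ E = 0) (hleft : d'.μ₁ E'ᶜ = 0) : μ (E \ E') = 0 := by
  have hright' : ∀ C ⊆ E \ E', MeasurableSet C → d.μ₂ C = 0 := fun C hC hmeas ↦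
    apply_eq_zero_of_subset hmeas hE (hC.trans Set.sdiff_subset) hright
  have hleft' : ∀ C ⊆ E \ E', MeasurableSet C → d'.μ₁ C = 0 := fun C hC hmeas ↦
    apply_eq_zero_of_subset hmeas hE'.compl (hC.trans (Set.sdiff_subset_compl E E')) hleft
  refine (d.apply_eq_zero_iff (hE.diff hE')).2 ⟨?_, hright' _ subset_rfl (hE.diff hE')⟩
  by_contra hne
  obtain ⟨C, hC, hatom⟩ := hatomic _ (hE.diff hE') hne
  have hatomμ : μ.IsAtom C := (d.isAtom_iff_left hatom.1 (hright' C hC hatom.1)).2 hatom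
  exact hnonatomic C ((d'.isAtom_iff_right hatom.1 (hleft' C hC hatom.1)).1 hatomμ)

theorem IsAtomicNonAtomic.eq (hμ : μ.IsNormalized) {d d' : μ.DirectSumDecomposition}
    (hd : d.IsAtomicNonAtomic) (hd' : d'.IsAtomicNonAtomic) : d = d' := by
  obtain ⟨-, hatomic, -, hnonatomic, hsing⟩ := hd
  obtain ⟨-, hatomic', -, hnonatomic', hsing'⟩ := hd'
  obtain ⟨E, hE, hleft, hright⟩ := mutuallySingular_iff.1 hsing
  obtain ⟨E', hE', hleft', hright'⟩ := mutuallySingular_iff.1 hsing'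
  have heq : μ E = μ E' := by
    rw [← μ.inter_add_diff hE hE', ← μ.inter_add_diff hE' hE, Set.inter_comm,
      apply_diff_eq_zero hatomic hnonatomic' hE hE' hright hleft',
      apply_diff_eq_zero hatomic' hnonatomic hE' hE hright' hleft]
  rw [d.apply_eq_starProjection hμ hE hleft hright,
    d'.apply_eq_starProjection hμ hE' hleft' hright'] at heq
  exact ext_of_left (ClosedSubmodule.toSubmodule_injective (Submodule.starProjection_inj.1 heq))

end DirectSumDecomposition

end Uniqueness

section Extremality

variable {X : Type*} [MeasurableSpace X]
variable {H : Type*} [NormedAddCommGroup H] [InnerProductSpace ℂ H] [CompleteSpace H]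
variable {μ : POVM X H} {A E : Set X} {n : ℕ}

theorem IsProperCStarCombination.apply_eq_zero {ν : Fin n → POVM X H} {T : Fin n → (H →L[ℂ] H)}
    (h : μ.IsProperCStarCombination ν T) (hA : MeasurableSet A) (h0 : μ A = 0) (i : Fin n) :
    ν i A = 0 := by
  obtain ⟨-, hT, -, hsum⟩ := h
  have hterm := (Finset.sum_eq_zero_iff_of_nonneg fun j _ ↦
    star_left_conjugate_nonneg ((ν j).nonneg hA) (T j)).1 ((hsum A hA).symm.trans h0) i
    (Finset.mem_univ i)
  rwa [(hT i).mul_left_eq_zero, (hT i).star.mul_right_eq_zero] at hterm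

theorem IsNormalized.isProperCStarCombination_self (hμ : μ.IsNormalized) (hn : 0 < n) :
    μ.IsProperCStarCombination (fun _ : Fin n ↦ μ) (fun _ ↦ √((n : ℝ)⁻¹) • 1) := by
  have hn' : (0 : ℝ) < (n : ℝ)⁻¹ := inv_pos.2 (Nat.cast_pos.2 hn)
  have hsum : ∀ R : H →L[ℂ] H, ∑ _ : Fin n, (n : ℝ)⁻¹ • R = R := fun R ↦ by
    rw [Finset.sum_const, Finset.card_univ, Fintype.card_fin, ← Nat.cast_smul_eq_nsmul ℝ,
      smul_inv_smul₀ (Nat.cast_ne_zero.2 hn.ne')]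
  have hterm : ∀ R : H →L[ℂ] H, star (√((n : ℝ)⁻¹) • (1 : H →L[ℂ] H)) * R *
      (√((n : ℝ)⁻¹) • (1 : H →L[ℂ] H)) = (n : ℝ)⁻¹ • R := fun R ↦ by
    rw [star_sqrt_smul_mul_mul hn'.le, star_one, one_mul, mul_one]
  have hterm_one : star (√((n : ℝ)⁻¹) • (1 : H →L[ℂ] H)) * (√((n : ℝ)⁻¹) • (1 : H →L[ℂ] H)) =
      (n : ℝ)⁻¹ • 1 := by
    simpa only [mul_one] using hterm 1
  exact ⟨fun _ ↦ hμ, fun _ ↦ isUnit_one.smul (Units.mk0 _ (Real.sqrt_pos.2 hn').ne'),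
    by simp only [hterm_one, hsum], fun A _ ↦ by simp only [hterm, hsum]⟩

namespace DirectSumDecomposition

variable (d : μ.DirectSumDecomposition)

theorem orthogonalProjectionOnto_left_add (x : d.K₁.toSubmodule) (y : d.K₂.toSubmodule) :
    d.K₁.toSubmodule.orthogonalProjectionOnto ((x : H) + (y : H)) = x := by
  have hy : (y : H) ∈ d.K₁.toSubmoduleᗮ := d.toSubmodule_K₂ ▸ y.2
  rw [map_add, Submodule.orthogonalProjectionOnto_mem_subspace_eq_self,
    Submodule.orthogonalProjectionOnto_apply_of_mem_orthogonal hy, add_zero]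

theorem orthogonalProjectionOnto_right_add (x : d.K₁.toSubmodule) (y : d.K₂.toSubmodule) :
    d.K₂.toSubmodule.orthogonalProjectionOnto ((x : H) + (y : H)) = y :=
  add_comm (x : H) y ▸ d.swap.orthogonalProjectionOnto_left_add y x

/-- The block diagonal operators `S ⊕ R` with respect to the orthogonal decomposition `H = K₁ ⊕ K₂`
underlying `d`, as a homomorphism of star algebras in the pair `(S, R)`. -/
noncomputable def blockDiag : (d.K₁.toSubmodule →L[ℂ] d.K₁.toSubmodule) ×
    (d.K₂.toSubmodule →L[ℂ] d.K₂.toSubmodule) →⋆ₐ[ℂ] (H →L[ℂ] H) where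
  toFun p := d.K₁.toSubmodule.subtypeL ∘L p.1 ∘L d.K₁.toSubmodule.orthogonalProjectionOnto +
    d.K₂.toSubmodule.subtypeL ∘L p.2 ∘L d.K₂.toSubmodule.orthogonalProjectionOnto
  map_zero' := by simp
  map_one' := by
    ext z
    obtain ⟨x, y, rfl⟩ := d.exists_eq_add z
    simp [orthogonalProjectionOnto_left_add, orthogonalProjectionOnto_right_add, -map_add]
  map_add' p q := by
    ext z
    simp [add_add_add_comm]
  map_mul' p q := by
    ext z
    simp [orthogonalProjectionOnto_left_add, orthogonalProjectionOnto_right_add, -map_add]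
  commutes' c := by
    ext z
    obtain ⟨x, y, rfl⟩ := d.exists_eq_add z
    simp [Algebra.algebraMap_eq_smul_one,
      orthogonalProjectionOnto_left_add, orthogonalProjectionOnto_right_add, -map_add]
  map_star' p := by
    simp [ContinuousLinearMap.star_eq_adjoint, ContinuousLinearMap.adjoint_comp,
      Submodule.adjoint_subtypeL, Submodule.adjoint_orthogonalProjectionOnto,
      ContinuousLinearMap.comp_assoc]

theorem blockDiag_apply_add (S : d.K₁.toSubmodule →L[ℂ] d.K₁.toSubmodule)
    (R : d.K₂.toSubmodule →L[ℂ] d.K₂.toSubmodule) (x : d.K₁.toSubmodule) (y : d.K₂.toSubmodule) :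
    d.blockDiag (S, R) ((x : H) + (y : H)) = (S x : H) + (R y : H) :=
  congrArg₂ (fun (u : d.K₁.toSubmodule) (v : d.K₂.toSubmodule) ↦ (S u : H) + (R v : H))
    (d.orthogonalProjectionOnto_left_add x y) (d.orthogonalProjectionOnto_right_add x y)

theorem apply_eq_blockDiag (hA : MeasurableSet A) : μ A = d.blockDiag (d.μ₁ A, d.μ₂ A) := by
  ext z
  obtain ⟨x, y, rfl⟩ := d.exists_eq_add z
  rw [d.eq_directSum A hA, blockDiag_apply_add]

theorem blockDiag_injective : Function.Injective d.blockDiag := by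
  refine (injective_iff_map_eq_zero d.blockDiag).2 fun p hp ↦ Prod.ext ?_ ?_
  · ext x
    simpa [hp] using (d.blockDiag_apply_add p.1 p.2 x 0).symm
  · ext y
    simpa [hp] using (d.blockDiag_apply_add p.1 p.2 0 y).symm

theorem exists_blockDiag_eq_of_commute {R : H →L[ℂ] H} (hR : Commute R (d.blockDiag (1, 0))) :
    ∃ p, d.blockDiag p = R := by
  refine ⟨(d.K₁.toSubmodule.orthogonalProjectionOnto ∘L R ∘L d.K₁.toSubmodule.subtypeL,
    d.K₂.toSubmodule.orthogonalProjectionOnto ∘L R ∘L d.K₂.toSubmodule.subtypeL), ?_⟩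
  have hsum : d.blockDiag (1, 0) + d.blockDiag (0, 1) = 1 := by
    rw [← map_add, Prod.mk_add_mk, add_zero, zero_add]
    exact map_one d.blockDiag
  have hR' : Commute R (d.blockDiag (0, 1)) :=
    eq_sub_of_add_eq' hsum ▸ (Commute.one_right R).sub_right hR
  calc _ = d.blockDiag (1, 0) * R * d.blockDiag (1, 0) +
        d.blockDiag (0, 1) * R * d.blockDiag (0, 1) := by ext z; simp [blockDiag]
    _ = R * d.blockDiag (1, 0) + R * d.blockDiag (0, 1) := by
        rw [← hR.eq, ← hR'.eq, mul_assoc, mul_assoc, ← map_mul, ← map_mul]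
        simp only [Prod.mk_mul_mk, mul_one, mul_zero]
    _ = R := by rw [← mul_add, hsum, mul_one]

/-- The direct sum of two POVMs acting on the two summands of the underlying decomposition of the
Hilbert space. -/
noncomputable def directSum (ν₁ : POVM X d.K₁.toSubmodule) (ν₂ : POVM X d.K₂.toSubmodule) :
    POVM X H :=
  ν₁.conj d.K₁.toSubmodule.orthogonalProjectionOnto +
    ν₂.conj d.K₂.toSubmodule.orthogonalProjectionOnto

theorem directSum_apply (ν₁ : POVM X d.K₁.toSubmodule) (ν₂ : POVM X d.K₂.toSubmodule) :
    d.directSum ν₁ ν₂ A = d.blockDiag (ν₁ A, ν₂ A) := by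
  ext z
  simp [directSum, add_apply, conj_apply_apply, Submodule.adjoint_orthogonalProjectionOnto,
    blockDiag]

theorem isProperCStarCombination_directSum {ν₁ : Fin n → POVM X d.K₁.toSubmodule}
    {ν₂ : Fin n → POVM X d.K₂.toSubmodule} {T₁ : Fin n → (d.K₁.toSubmodule →L[ℂ] d.K₁.toSubmodule)}
    {T₂ : Fin n → (d.K₂.toSubmodule →L[ℂ] d.K₂.toSubmodule)}
    (h₁ : d.μ₁.IsProperCStarCombination ν₁ T₁) (h₂ : d.μ₂.IsProperCStarCombination ν₂ T₂) :
    μ.IsProperCStarCombination (fun i ↦ d.directSum (ν₁ i) (ν₂ i))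
      (fun i ↦ d.blockDiag (T₁ i, T₂ i)) := by
  obtain ⟨hν₁, hT₁, hone₁, hsum₁⟩ := h₁
  obtain ⟨hν₂, hT₂, hone₂, hsum₂⟩ := h₂
  refine ⟨fun i ↦ ?_, fun i ↦ (Prod.isUnit_iff.2 ⟨hT₁ i, hT₂ i⟩).map d.blockDiag, ?_,
    fun A hA ↦ ?_⟩
  · rw [IsNormalized, directSum_apply, hν₁ i, hν₂ i]
    exact map_one d.blockDiag
  · simp only [← map_star, ← map_mul, ← map_sum]
    rw [← map_one d.blockDiag]
    exact congrArg d.blockDiag (Prod.ext (by simpa [Prod.fst_sum] using hone₁)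
      (by simpa [Prod.snd_sum] using hone₂))
  · simp only [directSum_apply, ← map_star, ← map_mul, ← map_sum, d.apply_eq_blockDiag hA]
    exact congrArg d.blockDiag (Prod.ext (by simpa [Prod.fst_sum] using hsum₁ A hA)
      (by simpa [Prod.snd_sum] using hsum₂ A hA))

theorem fst_mem_unitary_of_blockDiag_mem_unitary {p : (d.K₁.toSubmodule →L[ℂ] d.K₁.toSubmodule) ×
    (d.K₂.toSubmodule →L[ℂ] d.K₂.toSubmodule)}
    (h : d.blockDiag p ∈ unitary (H →L[ℂ] H)) :
    p.1 ∈ unitary (d.K₁.toSubmodule →L[ℂ] d.K₁.toSubmodule) := by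
  have hstar_mul : star p * p = 1 := d.blockDiag_injective <| by
    rw [map_mul, map_star, map_one, Unitary.star_mul_self_of_mem h]
  have hmul_star : p * star p = 1 := d.blockDiag_injective <| by
    rw [map_mul, map_star, map_one, Unitary.mul_star_self_of_mem h]
  exact ⟨congrArg Prod.fst hstar_mul, congrArg Prod.fst hmul_star⟩

theorem unitarilyEquivalent_left_of_directSum {ν₁ : POVM X d.K₁.toSubmodule}
    {ν₂ : POVM X d.K₂.toSubmodule} (h : (d.directSum ν₁ ν₂).UnitarilyEquivalent μ)
    (hE : MeasurableSet E) (hμ₁ : d.μ₁ E = 1) (hμ₂ : d.μ₂ E = 0) (hν₁ : ν₁ E = 1)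
    (hν₂ : ν₂ E = 0) : ν₁.UnitarilyEquivalent d.μ₁ := by
  obtain ⟨U, hU, hconj⟩ := h
  have hcommute : Commute U (d.blockDiag (1, 0)) := by
    have hE' := hconj E hE
    rw [directSum_apply, hν₁, hν₂, d.apply_eq_blockDiag hE, hμ₁, hμ₂] at hE'
    calc U * d.blockDiag (1, 0) = U * (star U * d.blockDiag (1, 0) * U) := by rw [← hE']
      _ = d.blockDiag (1, 0) * U := by
        rw [← mul_assoc, ← mul_assoc, Unitary.mul_star_self_of_mem hU, one_mul]
  obtain ⟨p, rfl⟩ := d.exists_blockDiag_eq_of_commute hcommute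
  refine ⟨p.1, d.fst_mem_unitary_of_blockDiag_mem_unitary hU, fun A hA ↦ ?_⟩
  have hA' := hconj A hA
  rw [directSum_apply, d.apply_eq_blockDiag hA, ← map_star, ← map_mul, ← map_mul] at hA'
  exact congrArg Prod.fst (d.blockDiag_injective hA')

theorem isCStarExtreme_left (hμ : μ.IsCStarExtreme) (hE : MeasurableSet E) (hleft : d.μ₁ Eᶜ = 0)
    (hright : d.μ₂ E = 0) : d.μ₁.IsCStarExtreme := by
  refine ⟨d.isNormalized_left hμ.1, fun n ν T hcomb i ↦ ?_⟩
  have hself := (d.isNormalized_right hμ.1).isProperCStarCombination_self i.pos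
  exact d.unitarilyEquivalent_left_of_directSum
    (hμ.2 n _ _ (d.isProperCStarCombination_directSum hcomb hself) i) hE
    (((d.isNormalized_left hμ.1).apply_compl_eq_zero_iff hE).1 hleft) hright
    (((hcomb.1 i).apply_compl_eq_zero_iff hE).1 (hcomb.apply_eq_zero hE.compl hleft i)) hright

theorem isCStarExtreme_right (hμ : μ.IsCStarExtreme) (hE : MeasurableSet E) (hleft : d.μ₁ Eᶜ = 0)
    (hright : d.μ₂ E = 0) : d.μ₂.IsCStarExtreme :=
  d.swap.isCStarExtreme_left hμ hE.compl ((compl_compl E).symm ▸ hright) hleft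

end DirectSumDecomposition

end Extremality

end POVM

theorem mainTheorem6 {X : Type*} [MeasurableSpace X]
    {H : Type*} [NormedAddCommGroup H] [InnerProductSpace ℂ H] [CompleteSpace H]
    [TopologicalSpace.SeparableSpace H]
    (μ : POVM X H) (hμ : μ.IsCStarExtreme) :
    (∃! d : μ.DirectSumDecomposition, d.IsAtomicNonAtomic) ∧
      ∀ d : μ.DirectSumDecomposition, d.IsAtomicNonAtomic →
        d.μ₁.IsCStarExtreme ∧ d.μ₂.IsCStarExtreme ∧ d.μ₁.IsSpectral := by
  refine ⟨?_, fun d hd ↦ ?_⟩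
  · obtain ⟨d, hd⟩ := hμ.exists_isAtomicNonAtomic
    exact ⟨d, hd, fun d' hd' ↦ hd'.eq hμ.1 hd⟩
  · obtain ⟨-, hatomic, -, -, hsingular⟩ := hd
    obtain ⟨E, hE, hleft, hright⟩ := POVM.mutuallySingular_iff.1 hsingular
    have hextreme := d.isCStarExtreme_left hμ hE hleft hright
    exact ⟨hextreme, d.isCStarExtreme_right hμ hE hleft hright,
      hextreme.isSpectral_of_isAtomic hatomic⟩
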